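/- Let $k\ge 1$ be an integer and $t\in(0,1)$, and let $(d_n)_n$ be a sequence of non-negative integers with $d_n\sim tnk$ as $n\to\infty$. On a probability space let, for all large $n$, $V_n:\mathbb C^{d_n}\to\mathbb C^k\otimes\mathbb C^n$ be a Haar-distributed random isometry, i.e. $V_n$ has the law of $U_nJ_n$ with $U_n$ a Haar-distributed unitary matrix of size $nk$ and $J_n:\mathbb C^{d_n}\to\mathbb C^k\otimes\mathbb C^n$ a fixed isometry (this law does not depend on $J_n$; no assumption is made on the joint law of the $V_n$ for different $n$). Define the random quantum channels $\Phi_n,\bar\Phi_n:M_{d_n}(\mathbb C)\to M_k(\mathbb C)$ by $$\Phi_n(X)=[\mathrm{id}_k\otimes\mathrm{Tr}_n](V_nXV_n^*),\qquad \bar\Phi_n(X)=[\mathrm{id}_k\otimes\mathrm{Tr}_n](\overline{V_n}\,X\,\overline{V_n}^{\,*}),$$ where $\overline{V_n}$ is the entrywise complex conjugate of $V_n$. Let $\Omega_{d}=\omega_d\omega_d^*$ with $\omega_d=\frac1{\sqrt d}\sum_{i=1}^d e_i\otimes e_i$ be the maximally entangled state, and let $$Z_n=[\Phi_n\otimes\bar\Phi_n](\Omega_{d_n})\in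 M_{k^2}(\mathbb C).$$ Then, almost surely as $n\to\infty$, the largest eigenvalue of the Hermitian matrix $Z_n$ converges to $t+\frac{1-t}{k^2}$, and each of its other $k^2-1$ eigenvalues (ordered decreasingly and counted with multiplicity) converges to $\frac{1-t}{k^2}$. -/

import Mathlib

open Filter Topology MeasureTheory ProbabilityTheory
open scoped Matrix Kronecker ComplexConjugate

noncomputable section

namespace RandomChannel

/-! ### Tensor products of matrix maps, channels, the maximally entangled state -/

section Channels

variable {a b d e k l : Type*} [Fintype a] [Fintype b] [Fintype d] [Fintype e]

/-- The partial trace `id ⊗ Tr` on `M_k(ℂ) ⊗ M_b(ℂ)`, over the second tensor factor. -/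
def partialTrace (X : Matrix (k × b) (k × b) ℂ) : Matrix k k ℂ :=
  Matrix.of fun i j => ∑ s, X (i, s) (j, s)

/-- The linear map `Φ(X) = [id ⊗ Tr](V X V*)` from `M_d(ℂ)` to `M_k(ℂ)` defined by a matrix
`V : ℂ^d → ℂ^k ⊗ ℂ^b`. It is a quantum channel when `V` is an isometry. -/
def channel (V : Matrix (k × b) d ℂ) : Matrix d d ℂ →ₗ[ℂ] Matrix k k ℂ where
  toFun X := partialTrace (V * X * Vᴴ)
  map_add' X Y := by
    ext i j
    simp [partialTrace, Matrix.mul_add, Matrix.add_mul, Finset.sum_add_distrib]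
  map_smul' c X := by
    ext i j
    simp [partialTrace, Finset.mul_sum]

/-- The tensor product `Φ ⊗ Ψ` of two linear maps between matrix algebras, where
`M_d(ℂ) ⊗ M_e(ℂ)` is identified with the matrices indexed by `d × e` by the Kronecker product;
see `tensorMap_kronecker`. -/
def tensorMap [DecidableEq d] [DecidableEq e]
    (Φ : Matrix d d ℂ →ₗ[ℂ] Matrix k k ℂ) (Ψ : Matrix e e ℂ →ₗ[ℂ] Matrix l l ℂ) :
    Matrix (d × e) (d × e) ℂ →ₗ[ℂ] Matrix (k × l) (k × l) ℂ where
  toFun X := ∑ p : d × e, ∑ q : d × e,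
    X p q • (Φ (Matrix.single p.1 q.1 1) ⊗ₖ Ψ (Matrix.single p.2 q.2 1))
  map_add' X Y := by
    simp [add_smul, Finset.sum_add_distrib]
  map_smul' c X := by
    simp [mul_smul, Finset.smul_sum]

lemma map_eq_sum_single [DecidableEq d] (Φ : Matrix d d ℂ →ₗ[ℂ] Matrix k k ℂ)
    (A : Matrix d d ℂ) : Φ A = ∑ i, ∑ j, A i j • Φ (Matrix.single i j 1) := by
  conv_lhs => rw [Matrix.matrix_eq_sum_single A]
  simp only [map_sum]
  refine Finset.sum_congr rfl fun i _ => Finset.sum_congr rfl fun j _ => ?_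
  rw [← map_smul, Matrix.smul_single, smul_eq_mul, mul_one]

/-- `Φ ⊗ Ψ` is the linear map with `(Φ ⊗ Ψ)(A ⊗ B) = Φ(A) ⊗ Ψ(B)`. -/
theorem tensorMap_kronecker [DecidableEq d] [DecidableEq e]
    (Φ : Matrix d d ℂ →ₗ[ℂ] Matrix k k ℂ) (Ψ : Matrix e e ℂ →ₗ[ℂ] Matrix l l ℂ)
    (A : Matrix d d ℂ) (B : Matrix e e ℂ) :
    tensorMap Φ Ψ (A ⊗ₖ B) = Φ A ⊗ₖ Ψ B := by
  rw [map_eq_sum_single Φ A, map_eq_sum_single Ψ B]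
  ext ⟨i, i'⟩ ⟨j, j'⟩
  simp only [tensorMap, LinearMap.coe_mk, AddHom.coe_mk, Matrix.sum_apply, Matrix.smul_apply,
    Matrix.kroneckerMap_apply, smul_eq_mul, Fintype.sum_prod_type, Finset.sum_mul_sum]
  refine Finset.sum_congr rfl fun x _ => Finset.sum_congr rfl fun y _ => ?_
  refine Finset.sum_congr rfl fun z _ => Finset.sum_congr rfl fun w _ => ?_
  ring

/-- The vector `ω_d = d^{-1/2} ∑ᵢ eᵢ ⊗ eᵢ` of `ℂ^d ⊗ ℂ^d`. -/
def bellVector (d : ℕ) : Fin d × Fin d → ℂ :=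
  (1 / (Real.sqrt d : ℂ)) • ∑ i : Fin d, Pi.single (i, i) 1

/-- The maximally entangled state `Ω_d = ω_d ω_d*`. -/
def bellState (d : ℕ) : Matrix (Fin d × Fin d) (Fin d × Fin d) ℂ :=
  Matrix.vecMulVec (bellVector d) (star (bellVector d))

/-- The output `Z = [Φ ⊗ Φ̄](Ω_d)`, where `Φ` is the channel of `V` and `Φ̄` is the channel of
the entrywise complex conjugate of `V`. -/
def bellOutput {d : ℕ} (V : Matrix (k × b) (Fin d) ℂ) : Matrix (k × k) (k × k) ℂ :=
  tensorMap (channel V) (channel (V.map conj)) (bellState d)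

lemma channel_conjTranspose (V : Matrix (k × b) d ℂ) (X : Matrix d d ℂ) :
    (channel V X)ᴴ = channel V Xᴴ := by
  have h : V * Xᴴ * Vᴴ = (V * X * Vᴴ)ᴴ := by
    simp [Matrix.conjTranspose_mul, Matrix.mul_assoc]
  ext i j
  simp [channel, partialTrace, h, Matrix.conjTranspose_apply]

theorem bellOutput_isHermitian {d : ℕ} (V : Matrix (k × b) (Fin d) ℂ) :
    (bellOutput V).IsHermitian := by
  unfold Matrix.IsHermitian bellOutput
  simp only [tensorMap, LinearMap.coe_mk, AddHom.coe_mk, Matrix.conjTranspose_sum,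
    Matrix.conjTranspose_smul, Matrix.conjTranspose_kronecker, channel_conjTranspose,
    Matrix.conjTranspose_single, star_one]
  rw [Finset.sum_comm]
  refine Finset.sum_congr rfl fun p _ => Finset.sum_congr rfl fun q _ => ?_
  congr 1
  simp [bellState, Matrix.vecMulVec_apply, mul_comm]

end Channels

/-! ### Random isometries -/

instance matrixMeasurableSpace {m n : Type*} : MeasurableSpace (Matrix m n ℂ) :=
  inferInstanceAs (MeasurableSpace (m → n → ℂ))

instance matrixBorelSpace {m n : Type*} [Countable m] [Countable n] : BorelSpace (Matrix m n ℂ) :=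
  inferInstanceAs (BorelSpace (m → n → ℂ))

instance unitaryGroup_compactSpace {N : Type*} [Fintype N] [DecidableEq N] :
    CompactSpace (Matrix.unitaryGroup N ℂ) := by
  suffices h : IsCompact (Matrix.unitaryGroup N ℂ : Set (Matrix N N ℂ)) from
    isCompact_iff_compactSpace.mp h
  have hK : IsCompact (Set.univ.pi fun _ : N => Set.univ.pi fun _ : N =>
      Metric.closedBall (0 : ℂ) 1) :=
    isCompact_univ_pi fun _ => isCompact_univ_pi fun _ => isCompact_closedBall _ _
  refine IsCompact.of_isClosed_subset (X := N → N → ℂ) hK ?_ ?_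
  · have h : (Matrix.unitaryGroup N ℂ : Set (Matrix N N ℂ)) = {A | A * star A = 1} := by
      ext A
      exact Matrix.mem_unitaryGroup_iff
    change IsClosed (Matrix.unitaryGroup N ℂ : Set (Matrix N N ℂ))
    rw [h]
    exact isClosed_eq (continuous_id.mul continuous_star) continuous_const
  · intro A hA i _ j _
    simpa using entry_norm_bound_of_unitary (𝕜 := ℂ) hA i j

/-- The Haar probability measure of the unitary group. -/
def haarUnitary (N : Type*) [Fintype N] [DecidableEq N] : Measure (Matrix.unitaryGroup N ℂ) :=
  Measure.haarMeasure ⊤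

instance haarUnitary_isProbabilityMeasure {N : Type*} [Fintype N] [DecidableEq N] :
    IsProbabilityMeasure (haarUnitary N) :=
  ⟨by simpa [haarUnitary] using Measure.haarMeasure_self (G := Matrix.unitaryGroup N ℂ) (K₀ := ⊤)⟩

/-- `V` is a (Haar-distributed) random isometry `ℂ^d → ℂ^N`: it has the law of `U J`, where `U` is
a Haar-distributed unitary matrix of `ℂ^N` and `J : ℂ^d → ℂ^N` is a fixed isometry (for instance
the inclusion of the first `d` coordinates). By invariance the law does not depend on `J`. -/
def IsRandomIsometry {Ω N d : Type*} [MeasurableSpace Ω] [Fintype N] [DecidableEq N]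
    [DecidableEq d] (V : Ω → Matrix N d ℂ) (P : Measure Ω) : Prop :=
  ∃ J : Matrix N d ℂ, Jᴴ * J = 1 ∧
    HasLaw V ((haarUnitary N).map fun U : Matrix.unitaryGroup N ℂ => (U : Matrix N N ℂ) * J) P

end RandomChannel

end

namespace RandomChannel

/-! ### Haar measure and infinitesimal conjugation invariance -/

section Haar

open scoped Matrix.Norms.L2Operator

variable {N : Type*} [Fintype N] [DecidableEq N]

/-! Contracting the Bell state turns each entry of `Z` into `1/d` times a quadratic trace `Tr (A P B
P)`, where `A`, `B` are matrix units tensored with the identity and `P = V V*` is a Haar-rotated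
projection of rank `d` (`bellOutput_eq_trace`). It suffices to show that this trace has fluctuations
of order one, since then an entry has mean-square error of order `1/d²`, which is summable in `n`.

The fluctuations are controlled without Weingarten calculus. Invariance under `P ↦ g P g*` gives
`E[Df(P)(XP - PX)] = 0` for holomorphic `f`. Take for `f` an entry of `APBP` times a centred
conjugate trace, let `X` run over the matrix units and sum: this is `loop_equation`. With `N` the
dimension, its main term contains `-N Tr (A P B P)` times the conjugate deviation, while
differentiating the centred trace leaves an error of size at most `4N`. For `B = 1` this bounds the
variance of `Tr (A P)` by a constant. For general `B`, the remaining traces are replaced by their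
means at a cost already controlled, and `Tr (A P B P)` is within a constant of `quadMean` in mean
square.

Summability gives almost sure entrywise convergence whatever the joint law. The limit is a multiple
of the identity plus `t` times a rank-one projection; its spectrum is recovered from the second and
third moments of the shifted eigenvalues. -/

instance haarUnitary_isMulLeftInvariant : (haarUnitary N).IsMulLeftInvariant := by
  unfold haarUnitary; infer_instance

lemma integrable_haarUnitary {f : Matrix.unitaryGroup N ℂ → ℂ} (hf : Continuous f) :
    Integrable f (haarUnitary N) :=
  hf.integrable_of_hasCompactSupport (HasCompactSupport.of_compactSpace f)

/-- The orbit map `U ↦ U Q U*`. -/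
abbrev unitaryConj (Q : Matrix N N ℂ) (U : Matrix.unitaryGroup N ℂ) : Matrix N N ℂ :=
  (U : Matrix N N ℂ) * Q * star (U : Matrix N N ℂ)

lemma continuous_unitaryConj (Q : Matrix N N ℂ) :
    Continuous fun U : Matrix.unitaryGroup N ℂ => unitaryConj Q U := by
  fun_prop

lemma unitaryConj_mul_self {Q : Matrix N N ℂ} (hQ : Q * Q = Q) (U : Matrix.unitaryGroup N ℂ) :
    unitaryConj Q U * unitaryConj Q U = unitaryConj Q U := by
  have hU : star (U : Matrix N N ℂ) * (U : Matrix N N ℂ) = 1 := Unitary.coe_star_mul_self U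
  calc _ = (U : Matrix N N ℂ) * Q * (star (U : Matrix N N ℂ) * (U : Matrix N N ℂ)) * Q *
        star (U : Matrix N N ℂ) := by noncomm_ring
    _ = (U : Matrix N N ℂ) * (Q * Q) * star (U : Matrix N N ℂ) := by rw [hU]; noncomm_ring
    _ = _ := by rw [hQ]

lemma unitaryConj_isStarProjection {Q : Matrix N N ℂ} (hQ : IsStarProjection Q)
    (U : Matrix.unitaryGroup N ℂ) : IsStarProjection (unitaryConj Q U) :=
  ⟨unitaryConj_mul_self hQ.isIdempotentElem.eq U, hQ.isSelfAdjoint.conjugate _⟩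

lemma trace_unitaryConj (Q : Matrix N N ℂ) (U : Matrix.unitaryGroup N ℂ) :
    (unitaryConj Q U).trace = Q.trace := by
  have : star (U : Matrix N N ℂ) * (U : Matrix N N ℂ) = 1 := Unitary.coe_star_mul_self U
  rw [Matrix.trace_mul_comm, ← mul_assoc, this, one_mul]

lemma integral_unitaryConj_left (f : Matrix N N ℂ → ℂ) (Q : Matrix N N ℂ)
    (g : Matrix.unitaryGroup N ℂ) :
    ∫ U : Matrix.unitaryGroup N ℂ, f ((g : Matrix N N ℂ) *
        unitaryConj Q U * star (g : Matrix N N ℂ)) ∂haarUnitary N =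
      ∫ U : Matrix.unitaryGroup N ℂ, f (unitaryConj Q U) ∂haarUnitary N := by
  rw [← integral_mul_left_eq_self (μ := haarUnitary N)
    (fun U : Matrix.unitaryGroup N ℂ => f (unitaryConj Q U)) g]
  simp [Matrix.mul_assoc]

/-- For skew-adjoint `X`, `exp (sX)` is unitary, so the integral of `f (exp (sX) P exp (-sX))` does
not depend on `s`; the claim is its derivative at `s = 0`. -/
lemma integral_fderiv_commutator_skew (f : Matrix N N ℂ → ℂ) (hf : ContDiff ℂ 1 f)
    (Q X : Matrix N N ℂ) (hX : star X = -X) :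
    ∫ U : Matrix.unitaryGroup N ℂ,
      fderiv ℂ f (unitaryConj Q U) (X * unitaryConj Q U - unitaryConj Q U * X) ∂haarUnitary N = 0 := by
  let +nondep : NormedAlgebra ℚ (Matrix N N ℂ) := .restrictScalars ℚ ℂ _
  set R : Matrix.unitaryGroup N ℂ → Matrix N N ℂ := unitaryConj Q with hR
  have hRc : Continuous R := continuous_unitaryConj Q
  let g : ℝ → Matrix N N ℂ := fun s => NormedSpace.exp (s • X)
  have hgc : Continuous g := by
    have := NormedSpace.exp_continuous (𝔸 := Matrix N N ℂ)
    fun_prop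
  have hgs : ∀ s, star (g s) = g (-s) := by
    intro s
    simp only [g]
    rw [NormedSpace.star_exp, star_smul, hX]
    simp
  have hgu : ∀ s, g s ∈ Matrix.unitaryGroup N ℂ := fun s =>
    NormedSpace.exp_mem_unitary_of_mem_skewAdjoint
      (by rw [skewAdjoint.mem_iff, star_smul, hX]; simp)
  have hgd : ∀ s, HasDerivAt g (g s * X) s := fun s => hasDerivAt_exp_smul_const (𝕂 := ℝ) X s
  have hgd' : ∀ s, HasDerivAt (fun s => g (-s)) (-(g (-s) * X)) s := fun s => by
    simpa using! (hgd (-s)).scomp s (hasDerivAt_neg s)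
  let D : ℝ → Matrix.unitaryGroup N ℂ → Matrix N N ℂ := fun s U =>
    g s * X * R U * g (-s) + g s * R U * -(g (-s) * X)
  let F : ℝ → Matrix.unitaryGroup N ℂ → ℂ := fun s U => f (g s * R U * g (-s))
  let F' : ℝ → Matrix.unitaryGroup N ℂ → ℂ := fun s U => fderiv ℂ f (g s * R U * g (-s)) (D s U)
  have hd : ∀ s U, HasDerivAt (fun s => F s U) (F' s U) s := by
    intro s U
    have h1 : HasDerivAt (fun s => g s * R U * g (-s)) (D s U) s :=
      ((hgd s).mul_const (R U)).mul (hgd' s)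
    have h2 := ((hf.differentiable one_ne_zero) (g s * R U * g (-s))).hasFDerivAt.restrictScalars ℝ
    exact h2.comp_hasDerivAt s h1
  have hfc : Continuous (fderiv ℂ f) := hf.continuous_fderiv one_ne_zero
  have hf0 : Continuous f := hf.continuous
  have hFc : ∀ s, Continuous (F s) := fun s => by
    simp only [F]; fun_prop
  have hFc' : Continuous (fun p : ℝ × Matrix.unitaryGroup N ℂ => F' p.1 p.2) := by
    simp only [F', D]
    apply Continuous.clm_apply <;> fun_prop
  -- Compactness of `[-1, 1] × U(N)` supplies the constant dominating the derivative under the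
  -- integral.
  obtain ⟨C, hC⟩ := ((isCompact_Icc (a := (-1 : ℝ)) (b := 1)).prod
    (isCompact_univ (X := Matrix.unitaryGroup N ℂ))).exists_bound_of_continuousOn hFc'.continuousOn
  have key := (hasDerivAt_integral_of_dominated_loc_of_deriv_le (μ := haarUnitary N)
    (F := F) (F' := F') (x₀ := (0 : ℝ)) (s := Set.Icc (-1) 1) (bound := fun _ => C)
    (Icc_mem_nhds (by norm_num) (by norm_num))
    (Eventually.of_forall fun s => (integrable_haarUnitary (hFc s)).aestronglyMeasurable)
    (integrable_haarUnitary (hFc 0))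
    (integrable_haarUnitary (f := F' 0) (by fun_prop)).aestronglyMeasurable
    (Eventually.of_forall fun U s hs => hC (s, U) ⟨hs, trivial⟩)
    (integrable_const C)
    (Eventually.of_forall fun U s _ => hd s U)).2
  have hconst : (fun s => ∫ U, F s U ∂haarUnitary N) = fun _ => ∫ U, f (R U) ∂haarUnitary N := by
    funext s
    have := integral_unitaryConj_left f Q ⟨g s, hgu s⟩
    simpa only [F, ← hgs] using this
  rw [hconst] at key
  have h0 := key.unique (hasDerivAt_const (0 : ℝ) (∫ U, f (R U) ∂haarUnitary N))
  rw [← h0]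
  congr 1
  funext U
  simp [F', D, g, hR, sub_eq_add_neg]

/-- The infinitesimal form of the invariance of the Haar measure. -/
theorem integral_fderiv_commutator (f : Matrix N N ℂ → ℂ) (hf : ContDiff ℂ 1 f)
    (Q X : Matrix N N ℂ) :
    ∫ U : Matrix.unitaryGroup N ℂ,
      fderiv ℂ f (unitaryConj Q U) (X * unitaryConj Q U - unitaryConj Q U * X) ∂haarUnitary N = 0 := by
  have hfc : Continuous (fderiv ℂ f) := hf.continuous_fderiv one_ne_zero
  have hRc := continuous_unitaryConj Q
  have hint : ∀ Y : Matrix N N ℂ, Integrable (fun U : Matrix.unitaryGroup N ℂ =>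
      fderiv ℂ f (unitaryConj Q U) (Y * unitaryConj Q U - unitaryConj Q U * Y)) (haarUnitary N) := fun Y => by
    apply integrable_haarUnitary
    apply Continuous.clm_apply <;> fun_prop
  -- `X = X₁ + i X₂` with both parts skew-adjoint. The derivative of `f` is complex linear, so the
  -- skew case extends to every `X`.
  set X₁ : Matrix N N ℂ := (1 / 2 : ℂ) • (X - star X)
  set X₂ : Matrix N N ℂ := (-Complex.I / 2) • (X + star X)
  have h1 := integral_fderiv_commutator_skew f hf Q X₁ (by
    simp [X₁, star_smul, ← smul_neg])
  have h2 := integral_fderiv_commutator_skew f hf Q (-X₂) (by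
    simp only [X₂, star_neg, star_smul, star_add, star_star]
    rw [add_comm (star X) X, ← neg_smul]
    simp [neg_div])
  have hX : X = X₁ + (-Complex.I) • (-X₂) := by
    have : Complex.I * (-Complex.I / 2) = 1 / 2 := by
      rw [mul_div_assoc', mul_neg, Complex.I_mul_I, neg_neg]
    rw [smul_neg, neg_smul, neg_neg]
    simp only [X₁, X₂, smul_smul]
    rw [this, ← smul_add, sub_add_add_cancel, ← two_smul ℂ X, smul_smul]
    norm_num
  have : ∀ U : Matrix.unitaryGroup N ℂ, fderiv ℂ f (unitaryConj Q U) (X * unitaryConj Q U - unitaryConj Q U * X) =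
      fderiv ℂ f (unitaryConj Q U) (X₁ * unitaryConj Q U - unitaryConj Q U * X₁) + (-Complex.I) *
      fderiv ℂ f (unitaryConj Q U) (-X₂ * unitaryConj Q U - unitaryConj Q U * -X₂) := by
    intro U
    generalize unitaryConj Q U = R
    rw [← smul_eq_mul (-Complex.I), ← map_smul, ← map_add]
    congr 1
    conv_lhs => rw [hX]
    generalize X₁ = Z, -X₂ = Y, -Complex.I = c
    simp only [add_mul, mul_add, smul_sub, smul_mul_assoc, mul_smul_comm]
    abel
  simp_rw [this]
  rw [integral_add (hint _) ((hint _).const_mul _), integral_const_mul, h1, h2]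
  simp

end Haar

/-! ### The loop equation for a random projection -/

section LoopEquation

open scoped Matrix.Norms.L2Operator

variable {N : Type*} [Fintype N] [DecidableEq N]

/-- Summing over matrix units splits one product into two traces, which is where the products of
traces in the loop equation come from. -/
lemma sum_mul_single_mul_apply (L R : Matrix N N ℂ) :
    ∑ i, ∑ j, (L * Matrix.single i j 1 * R : Matrix N N ℂ) i j = L.trace * R.trace := by
  simp [Matrix.mul_apply, Matrix.single_apply, Matrix.trace, Finset.sum_mul_sum, ite_and]

lemma sum_mul_trace_mul_single (W K : Matrix N N ℂ) :
    ∑ i, ∑ j, W i j * (K * Matrix.single i j 1).trace = (W * K).trace := by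
  simp [Matrix.trace, Matrix.mul_apply, Matrix.single_apply, ite_and]

lemma norm_trace_le (M : Matrix N N ℂ) : ‖M.trace‖ ≤ Fintype.card N * ‖M‖ := by
  have h : ∀ i, ‖M i i‖ ≤ ‖M‖ := fun i => by
    have h1 := Matrix.l2_opNorm_mulVec M (EuclideanSpace.single i (1 : ℂ))
    have h2 := PiLp.norm_apply_le (WithLp.toLp 2 (M *ᵥ (EuclideanSpace.single i (1 : ℂ)).ofLp)) i
    simp at h1 h2
    exact h2.trans h1
  calc ‖M.trace‖ ≤ ∑ i, ‖M i i‖ := norm_sum_le _ _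
    _ ≤ ∑ _i : N, ‖M‖ := Finset.sum_le_sum fun i _ => h i
    _ = _ := by simp

/-- The test function of the loop equation. -/
def loopTest (A B : Matrix N N ℂ) (c : ℂ) (i j : N) (R : Matrix N N ℂ) : ℂ :=
  (A * R * B * R) i j * ((star A * R * star B * R).trace - c)

lemma contDiff_loopTest (A B : Matrix N N ℂ) (c : ℂ) (i j : N) :
    ContDiff ℂ 1 (loopTest A B c i j) := by
  have h : ∀ A B : Matrix N N ℂ, ContDiff ℂ 1 fun R : Matrix N N ℂ => A * R * B * R := by
    intro A B; fun_prop
  have h1 := (LinearMap.toContinuousLinearMap (Matrix.entryLinearMap ℂ ℂ i j)).contDiff.comp (h A B)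
  have h2 := (LinearMap.toContinuousLinearMap (Matrix.traceLinearMap N ℂ ℂ)).contDiff.comp
    (h (star A) (star B))
  exact h1.mul (h2.sub contDiff_const)

lemma fderiv_loopTest (A B : Matrix N N ℂ) (c : ℂ) (i j : N) (P Y : Matrix N N ℂ) :
    fderiv ℂ (loopTest A B c i j) P Y =
      (A * Y * B * P + A * P * B * Y) i j * ((star A * P * star B * P).trace - c) +
      (A * P * B * P) i j * (star A * Y * star B * P + star A * P * star B * Y).trace := by
  have hp : HasDerivAt (fun s : ℂ => P + s • Y) Y 0 := by
    simpa using! ((hasDerivAt_id (0 : ℂ)).smul_const Y).const_add P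
  have h0 : P + (0 : ℂ) • Y = P := by simp
  have h1 : HasDerivAt (fun s : ℂ => loopTest A B c i j (P + s • Y))
      (fderiv ℂ (loopTest A B c i j) P Y) 0 := by
    have := ((contDiff_loopTest A B c i j).differentiable one_ne_zero
      (P + (0 : ℂ) • Y)).hasFDerivAt.comp_hasDerivAt (0 : ℂ) hp
    rwa [h0] at this
  have hq : ∀ A B : Matrix N N ℂ, HasDerivAt
      (fun s : ℂ => A * (P + s • Y) * B * (P + s • Y)) (A * Y * B * P + A * P * B * Y) 0 := by
    intro A B
    have := ((hp.const_mul A).mul_const B).mul hp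
    rwa [h0] at this
  have h2 := (LinearMap.toContinuousLinearMap
    (Matrix.entryLinearMap ℂ ℂ i j)).hasFDerivAt.comp_hasDerivAt (0 : ℂ) (hq A B)
  have h3 := (LinearMap.toContinuousLinearMap
    (Matrix.traceLinearMap N ℂ ℂ)).hasFDerivAt.comp_hasDerivAt (0 : ℂ) (hq (star A) (star B))
  have h4 := h2.mul (h3.sub_const c)
  have := h1.unique h4
  rw [this]
  simp

/-- Differentiating the entry of `APBP` gives the products of traces. Differentiating the trace
factor gives a single trace, of lower order. -/
lemma sum_fderiv_loopTest (A B P : Matrix N N ℂ) (c : ℂ) (hP : P * P = P) :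
    ∑ i, ∑ j, fderiv ℂ (loopTest A B c i j) P
      (Matrix.single i j 1 * P - P * Matrix.single i j 1) =
    (A.trace * (P * B).trace + P.trace * (P * (B * A)).trace - (A * P).trace * (B * P).trace
      - Fintype.card N * (A * P * B * P).trace) * ((star A * P * star B * P).trace - c) +
    (A * P * B * P * (P * (star B * P * star A + star A * P * star B) -
      (star B * P * star A + star A * P * star B) * P)).trace := by
  have e1 : ∀ i j, fderiv ℂ (loopTest A B c i j) P
      (Matrix.single i j 1 * P - P * Matrix.single i j 1) =
      ((A * Matrix.single i j 1 * (P * B * P) : Matrix N N ℂ) i j - (A * P * Matrix.single i j 1 * (B * P) : Matrix N N ℂ) i j +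
        (A * P * B * Matrix.single i j 1 * P : Matrix N N ℂ) i j - (A * P * B * P * Matrix.single i j 1 * 1 : Matrix N N ℂ) i j)
        * ((star A * P * star B * P).trace - c) +
      (A * P * B * P) i j * ((P * (star B * P * star A + star A * P * star B) -
      (star B * P * star A + star A * P * star B) * P) * Matrix.single i j 1).trace := by
    intro i j
    rw [fderiv_loopTest]
    generalize Matrix.single i j (1 : ℂ) = E
    congr 1
    · congr 1
      simp only [← Matrix.sub_apply, ← Matrix.add_apply]
      refine congrFun (congrFun ?_ i) j
      noncomm_ring
    · congr 1
      have t1 : (star A * (E * P - P * E) * star B * P).trace =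
          ((star B * P * star A) * (E * P - P * E)).trace := by
        rw [Matrix.mul_assoc (star A * _), Matrix.trace_mul_comm, ← Matrix.mul_assoc]
      have t2 : ∀ C : Matrix N N ℂ, (C * (E * P - P * E)).trace = ((P * C - C * P) * E).trace := by
        intro C
        rw [mul_sub, sub_mul, Matrix.trace_sub, Matrix.trace_sub, ← mul_assoc, ← mul_assoc,
          Matrix.trace_mul_comm (C * E) P, ← mul_assoc]
      rw [Matrix.trace_add, t1, ← Matrix.trace_add, ← add_mul, t2]
  simp_rw [e1]
  simp only [Finset.sum_add_distrib, ← Finset.sum_mul, Finset.sum_sub_distrib,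
    sum_mul_single_mul_apply, sum_mul_trace_mul_single]
  have e2 : (P * B * P).trace = (P * B).trace := by
    rw [Matrix.trace_mul_comm, ← mul_assoc, hP]
  have e3 : (A * P * B).trace = (P * (B * A)).trace := by
    rw [mul_assoc, Matrix.trace_mul_comm, mul_assoc]
  rw [e2, e3, Matrix.trace_one]
  ring

/-- The loop equation for a random projection of fixed rank. -/
theorem loop_equation (A B Q : Matrix N N ℂ) (c : ℂ) (hQ : Q * Q = Q) :
    ∫ U : Matrix.unitaryGroup N ℂ, (fun P : Matrix N N ℂ =>
      (A.trace * (P * B).trace + Q.trace * (P * (B * A)).trace - (A * P).trace * (B * P).trace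
      - Fintype.card N * (A * P * B * P).trace) * ((star A * P * star B * P).trace - c) +
      (A * P * B * P * (P * (star B * P * star A + star A * P * star B) -
      (star B * P * star A + star A * P * star B) * P)).trace)
        (unitaryConj Q U) ∂haarUnitary N = 0 := by
  have h : ∀ i j : N, Integrable (fun U : Matrix.unitaryGroup N ℂ =>
      fderiv ℂ (loopTest A B c i j) (unitaryConj Q U)
        (Matrix.single i j 1 * unitaryConj Q U -
        unitaryConj Q U * Matrix.single i j 1))
        (haarUnitary N) := fun i j => by
    have hfc := (contDiff_loopTest A B c i j).continuous_fderiv one_ne_zero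
    apply integrable_haarUnitary
    apply Continuous.clm_apply <;> fun_prop
  have key : ∀ U : Matrix.unitaryGroup N ℂ, _ := fun U =>
    sum_fderiv_loopTest A B (unitaryConj Q U) c (unitaryConj_mul_self hQ U)
  simp only [trace_unitaryConj] at key
  simp only [← key]
  rw [integral_finsetSum _ fun i _ => integrable_finsetSum _ fun j _ => h i j]
  refine Finset.sum_eq_zero fun i _ => ?_
  rw [integral_finsetSum _ fun j _ => h i j]
  exact Finset.sum_eq_zero fun j _ =>
    integral_fderiv_commutator _ (contDiff_loopTest A B c i j) Q _

end LoopEquation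

/-! ### Variance bounds for linear and quadratic traces -/

section Fluctuations

open scoped Matrix.Norms.L2Operator

variable {N : Type*} [Fintype N] [DecidableEq N]

lemma norm_mul_le_one {A B : Matrix N N ℂ} (hA : ‖A‖ ≤ 1) (hB : ‖B‖ ≤ 1) : ‖A * B‖ ≤ 1 :=
  (norm_mul_le A B).trans (mul_le_one₀ hA (norm_nonneg _) hB)

lemma norm_trace_le_card {A : Matrix N N ℂ} (hA : ‖A‖ ≤ 1) : ‖A.trace‖ ≤ Fintype.card N :=
  (norm_trace_le A).trans (mul_le_of_le_one_right (by positivity) hA)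

/-- The remainder is one trace of an operator of norm at most 4: a commutator of `P` with an
operator of norm at most 2, times a contraction. -/
lemma norm_loop_remainder_le {A B P : Matrix N N ℂ} (hA : ‖A‖ ≤ 1) (hB : ‖B‖ ≤ 1) (hP : ‖P‖ ≤ 1) :
    ‖(A * P * B * P * (P * (star B * P * star A + star A * P * star B) -
      (star B * P * star A + star A * P * star B) * P)).trace‖ ≤ 4 * Fintype.card N := by
  have hA' : ‖star A‖ ≤ 1 := by rwa [norm_star]
  have hB' : ‖star B‖ ≤ 1 := by rwa [norm_star]
  refine (norm_trace_le _).trans ?_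
  rw [mul_comm]
  refine mul_le_mul_of_nonneg_right ?_ (by positivity)
  have hC : ‖star B * P * star A + star A * P * star B‖ ≤ 2 := by
    refine (norm_add_le _ _).trans ?_
    have h1 := norm_mul_le_one (norm_mul_le_one hB' hP) hA'
    have h2 := norm_mul_le_one (norm_mul_le_one hA' hP) hB'
    linarith
  generalize star B * P * star A + star A * P * star B = C at hC
  have h1 : ‖A * P * B * P‖ ≤ 1 := norm_mul_le_one (norm_mul_le_one (norm_mul_le_one hA hP) hB) hP
  have h2 : ‖P * C - C * P‖ ≤ 4 := by
    have h3 : ‖P * C‖ ≤ 1 * 2 := norm_mul_le_of_le hP hC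
    have h4 : ‖C * P‖ ≤ 2 * 1 := norm_mul_le_of_le hC hP
    linarith [norm_sub_le (P * C) (C * P)]
  calc _ ≤ 1 * 4 := norm_mul_le_of_le h1 h2
    _ = 4 := by norm_num

lemma integral_nonneg_of_re_le {f : Matrix.unitaryGroup N ℂ → ℂ} {h : Matrix.unitaryGroup N ℂ → ℝ}
    (hf : Continuous f) (hh : Continuous h) (h0 : ∫ U, f U ∂haarUnitary N = 0)
    (hfh : ∀ U, (f U).re ≤ h U) : 0 ≤ ∫ U, h U ∂haarUnitary N := by
  have h1 : ∫ U, (f U).re ∂haarUnitary N = 0 := by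
    have := integral_re (𝕜 := ℂ) (integrable_haarUnitary hf)
    simpa [h0] using! this
  have hr : Integrable h (haarUnitary N) :=
    hh.integrable_of_hasCompactSupport (HasCompactSupport.of_compactSpace h)
  rw [← h1]
  exact integral_mono (integrable_haarUnitary hf).re hr hfh

/-- The deviation of `Tr (A P)` from its expectation, for a random projection `P` of density `τ`. -/
def linearDev (τ : ℂ) (A P : Matrix N N ℂ) : ℂ := (A * P).trace - τ * A.trace

/-- The main term of the expectation of `Tr (A P B P)`, for a random projection `P` with
trace `d`. -/
noncomputable def quadMean (d : ℂ) (A B : Matrix N N ℂ) : ℂ :=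
  (d / Fintype.card N * A.trace * B.trace + d * (d / Fintype.card N) * (B * A).trace -
    (d / Fintype.card N) ^ 2 * A.trace * B.trace) / Fintype.card N

-- This is why `loopTest` uses `star A` and `star B`: its trace factor is holomorphic in `R`, yet at
-- a self-adjoint projection it is the conjugate of `Tr (A P B P)`.
omit [DecidableEq N] in
lemma trace_star_quad {P : Matrix N N ℂ} (hP : IsSelfAdjoint P) (A B : Matrix N N ℂ) :
    (star A * P * star B * P).trace = conj (A * P * B * P).trace := by
  have h := Matrix.trace_conjTranspose (A * P * B * P)
  rw [starRingEnd_apply, ← h, ← Matrix.star_eq_conjTranspose]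
  simp only [star_mul, hP.star_eq]
  rw [mul_assoc (star A * P), Matrix.trace_mul_comm, Matrix.trace_mul_comm P]
  simp only [mul_assoc]

variable [Nonempty N]

/-- At `B = 1`, `P² = P` collapses the quadratic trace to `Tr (A P)` and two terms cancel. The
bracket becomes `-N` times the deviation, and the chosen centring makes the other factor its
conjugate. -/
lemma re_loop_integrand_one_le {A P : Matrix N N ℂ} (hA : ‖A‖ ≤ 1) (hP : IsStarProjection P) :
    ((A.trace * (P * 1).trace + P.trace * (P * (1 * A)).trace - (A * P).trace * (1 * P).trace
      - Fintype.card N * (A * P * 1 * P).trace) * ((star A * P * star 1 * P).trace -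
        conj (P.trace / Fintype.card N * A.trace)) +
      (A * P * 1 * P * (P * (star 1 * P * star A + star A * P * star 1) -
      (star 1 * P * star A + star A * P * star 1) * P)).trace).re ≤
    4 * Fintype.card N - Fintype.card N * ‖linearDev (P.trace / Fintype.card N) A P‖ ^ 2 := by
  have hK := (Complex.re_le_norm _).trans
    (norm_loop_remainder_le hA (norm_one (α := Matrix N N ℂ)).le hP.norm_le)
  rw [Complex.add_re]
  refine (add_le_add_right hK _).trans ?_
  have hnC : (Fintype.card N : ℂ) ≠ 0 := by simp
  have e1 : A * P * 1 * P = A * P := by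
    rw [mul_one, mul_assoc, hP.isIdempotentElem.eq]
  have e2 : A.trace * P.trace + P.trace * (A * P).trace - (A * P).trace * P.trace -
      Fintype.card N * (A * P).trace =
      -Fintype.card N * linearDev (P.trace / Fintype.card N) A P := by
    unfold linearDev; field_simp; ring
  have e3 : -Fintype.card N * linearDev (P.trace / Fintype.card N) A P *
      conj (linearDev (P.trace / Fintype.card N) A P) =
      ((-Fintype.card N * ‖linearDev (P.trace / Fintype.card N) A P‖ ^ 2 : ℝ) : ℂ) := by
    rw [mul_assoc, Complex.mul_conj, Complex.normSq_eq_norm_sq]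
    push_cast
    ring
  rw [trace_star_quad hP.isSelfAdjoint, e1, mul_one, one_mul, one_mul, Matrix.trace_mul_comm P A,
    ← map_sub, e2, ← linearDev, e3, Complex.ofReal_re]
  linarith

theorem integral_norm_sq_linearDev_le {A Q : Matrix N N ℂ} (hA : ‖A‖ ≤ 1)
    (hQ : IsStarProjection Q) :
    ∫ U, ‖linearDev (Q.trace / Fintype.card N) A (unitaryConj Q U)‖ ^ 2 ∂haarUnitary N ≤ 4 := by
  have hn0 : 0 < (Fintype.card N : ℝ) := by simp [Fintype.card_pos]
  have hc : Continuous (unitaryConj Q) := continuous_unitaryConj Q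
  have loop := loop_equation A 1 Q (conj (Q.trace / Fintype.card N * A.trace))
    hQ.isIdempotentElem.eq
  have hcx : Continuous fun U => ‖linearDev (Q.trace / Fintype.card N) A (unitaryConj Q U)‖ ^ 2 := by
    unfold linearDev
    fun_prop
  have h := integral_nonneg_of_re_le
    (h := fun U => Fintype.card N *
      (4 - ‖linearDev (Q.trace / Fintype.card N) A (unitaryConj Q U)‖ ^ 2))
    (by fun_prop) (by fun_prop) loop (fun U => by
      have h1 := re_loop_integrand_one_le hA (unitaryConj_isStarProjection hQ U)
      simp only [trace_unitaryConj] at h1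
      rw [mul_sub, mul_comm _ (4 : ℝ)]
      exact h1)
  rw [integral_const_mul, integral_sub (integrable_const _) (hcx.integrable_of_hasCompactSupport
    (HasCompactSupport.of_compactSpace _)), integral_const] at h
  simp only [probReal_univ, smul_eq_mul, one_mul] at h
  linarith [nonneg_of_mul_nonneg_right h hn0]

/-- `quadMean` solves the loop equation with every `Tr (M P)` replaced by `τ Tr M`. After
subtracting it, the source term is linear in the deviations of `B`, `BA` and `A` with coefficients
of size at most `N`, so the linear variance bound closes the estimate. -/
theorem integral_norm_sq_quad_sub_quadMean_le {A B Q : Matrix N N ℂ} (hA : ‖A‖ ≤ 1) (hB : ‖B‖ ≤ 1)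
    (hQ : IsStarProjection Q) :
    ∫ U, ‖(A * unitaryConj Q U * B * unitaryConj Q U).trace - quadMean Q.trace A B‖ ^ 2
      ∂haarUnitary N ≤ 80 := by
  set n : ℝ := (Fintype.card N : ℝ) with hn
  have hn0 : 0 < n := by simp [hn, Fintype.card_pos]
  have hnC : (Fintype.card N : ℂ) ≠ 0 := by simp
  have hc : Continuous (unitaryConj Q) := continuous_unitaryConj Q
  set τ : ℂ := Q.trace / Fintype.card N with hτ
  have loop := loop_equation A B Q (conj (quadMean Q.trace A B)) hQ.isIdempotentElem.eq
  have hx : ∀ M : Matrix N N ℂ, Continuous fun U => ‖linearDev τ M (unitaryConj Q U)‖ ^ 2 := by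
    intro M
    unfold linearDev
    fun_prop
  have hz : Continuous fun U =>
      ‖(A * unitaryConj Q U * B * unitaryConj Q U).trace - quadMean Q.trace A B‖ ^ 2 := by
    fun_prop
  have hxi : ∀ M : Matrix N N ℂ, Integrable (fun U => ‖linearDev τ M (unitaryConj Q U)‖ ^ 2)
      (haarUnitary N) := fun M => (hx M).integrable_of_hasCompactSupport
    (HasCompactSupport.of_compactSpace _)
  have hzi : Integrable (fun U =>
      ‖(A * unitaryConj Q U * B * unitaryConj Q U).trace - quadMean Q.trace A B‖ ^ 2)
      (haarUnitary N) := hz.integrable_of_hasCompactSupport (HasCompactSupport.of_compactSpace _)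
  have hxB := hx B
  have hxBA := hx (B * A)
  have hxA := hx A
  have h := integral_nonneg_of_re_le
    (h := fun U => n * (4 + 6 * ‖linearDev τ B (unitaryConj Q U)‖ ^ 2 +
      3 / 2 * ‖linearDev τ (B * A) (unitaryConj Q U)‖ ^ 2 +
      3 / 2 * ‖linearDev τ A (unitaryConj Q U)‖ ^ 2 - 1 / 2 *
      ‖(A * unitaryConj Q U * B * unitaryConj Q U).trace - quadMean Q.trace A B‖ ^ 2))
    (by fun_prop) (by fun_prop) loop (fun U => by
      have hP := unitaryConj_isStarProjection hQ U
      have hPt := trace_unitaryConj Q U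
      change ((_ : ℂ) + _).re ≤ _
      rw [Complex.add_re]
      have hK := (Complex.re_le_norm _).trans (norm_loop_remainder_le hA hB (hP.norm_le))
      rw [← hn] at hK
      refine (add_le_add_right hK _).trans ?_
      rw [trace_star_quad hP.isSelfAdjoint]
      change (((A.trace * (unitaryConj Q U * B).trace + Q.trace * (unitaryConj Q U * (B * A)).trace -
        (A * unitaryConj Q U).trace * (B * unitaryConj Q U).trace -
        Fintype.card N * (A * unitaryConj Q U * B * unitaryConj Q U).trace) *
        (conj (A * unitaryConj Q U * B * unitaryConj Q U).trace - _) : ℂ).re + 4 * n) ≤ _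
      generalize unitaryConj Q U = P at hP hPt
      have hAt := norm_trace_le_card hA
      have hBt := norm_trace_le_card hB
      have hdt : ‖Q.trace‖ ≤ n := by rw [← hPt]; exact norm_trace_le_card hP.norm_le
      have hAPt := norm_trace_le_card (norm_mul_le_one hA hP.norm_le)
      have hτ1 : ‖τ‖ ≤ 1 := by
        rw [hτ, norm_div]
        simp only [Complex.norm_natCast]
        exact div_le_one_of_le₀ hdt hn0.le
      rw [← hn] at hAt hBt hAPt
      rw [Matrix.trace_mul_comm P B, Matrix.trace_mul_comm P (B * A), ← map_sub]
      set z := (A * P * B * P).trace - quadMean Q.trace A B with hzdef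
      -- The product of traces is telescoped: `Tr(AP) Tr(BP) - τ² Tr A Tr B` equals `Tr(AP)` times
      -- the deviation of `B` plus `τ Tr B` times that of `A`.
      set y := A.trace * linearDev τ B P + Q.trace * linearDev τ (B * A) P -
        ((A * P).trace * linearDev τ B P + τ * B.trace * linearDev τ A P) with hy
      have e1 : A.trace * (B * P).trace + Q.trace * (B * A * P).trace -
          (A * P).trace * (B * P).trace - Fintype.card N * (A * P * B * P).trace =
          y - Fintype.card N * z := by
        rw [hy, hzdef, quadMean]
        unfold linearDev
        rw [mul_sub (Fintype.card N : ℂ), mul_div_cancel₀ _ hnC, ← hτ]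
        ring
      have e2 : ((y - Fintype.card N * z) * conj z).re = (y * conj z).re - n * ‖z‖ ^ 2 := by
        rw [sub_mul, mul_assoc, Complex.mul_conj, Complex.normSq_eq_norm_sq, Complex.sub_re]
        congr 1
        rw [← Complex.ofReal_natCast, ← Complex.ofReal_mul, Complex.ofReal_re]
      rw [e1, e2]
      have hyn : ‖y‖ ≤ n * (2 * ‖linearDev τ B P‖ + ‖linearDev τ (B * A) P‖ + ‖linearDev τ A P‖) := by
        have t1 : ‖A.trace * linearDev τ B P‖ ≤ n * ‖linearDev τ B P‖ :=
          norm_mul_le_of_le hAt le_rfl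
        have t2 : ‖Q.trace * linearDev τ (B * A) P‖ ≤ n * ‖linearDev τ (B * A) P‖ :=
          norm_mul_le_of_le hdt le_rfl
        have t3 : ‖(A * P).trace * linearDev τ B P‖ ≤ n * ‖linearDev τ B P‖ :=
          norm_mul_le_of_le hAPt le_rfl
        have t4 : ‖τ * B.trace * linearDev τ A P‖ ≤ 1 * n * ‖linearDev τ A P‖ :=
          norm_mul_le_of_le (norm_mul_le_of_le hτ1 hBt) le_rfl
        refine (norm_sub_le _ _).trans ?_
        have t5 := norm_add_le (A.trace * linearDev τ B P) (Q.trace * linearDev τ (B * A) P)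
        have t6 := norm_add_le ((A * P).trace * linearDev τ B P) (τ * B.trace * linearDev τ A P)
        linarith
      have hyz : (y * conj z).re ≤ ‖y‖ * ‖z‖ := by
        refine (Complex.re_le_norm _).trans ?_
        rw [norm_mul, RCLike.norm_conj]
      generalize ‖linearDev τ B P‖ = a at *
      generalize ‖linearDev τ (B * A) P‖ = b at *
      generalize ‖linearDev τ A P‖ = c at *
      have h7 : ‖y‖ * ‖z‖ ≤ n * ((2 * a + b + c) * ‖z‖) := by
        rw [← mul_assoc]; exact mul_le_mul_of_nonneg_right hyn (norm_nonneg _)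
      -- Young's inequality, then `(2a + b + c)² ≤ 3 (4a² + b² + c²)`.
      have h8 : (2 * a + b + c) * ‖z‖ ≤ 6 * a ^ 2 + 3 / 2 * b ^ 2 + 3 / 2 * c ^ 2 + 1 / 2 * ‖z‖ ^ 2 := by
        nlinarith [sq_nonneg (2 * a + b + c - ‖z‖), sq_nonneg (2 * a - b), sq_nonneg (2 * a - c),
          sq_nonneg (b - c)]
      have h9 := mul_le_mul_of_nonneg_left h8 hn0.le
      linarith)
  have iB := integral_norm_sq_linearDev_le hB hQ
  have iBA := integral_norm_sq_linearDev_le (norm_mul_le_one hB hA) hQ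
  have iA := integral_norm_sq_linearDev_le hA hQ
  rw [integral_const_mul, integral_sub (by
      exact (((integrable_const _).add ((hxi B).const_mul _)).add ((hxi _).const_mul _)).add
        ((hxi _).const_mul _)) (hzi.const_mul _),
    integral_add (by
      exact ((integrable_const _).add ((hxi B).const_mul _)).add ((hxi _).const_mul _))
        ((hxi _).const_mul _),
    integral_add (by exact (integrable_const _).add ((hxi B).const_mul _)) ((hxi _).const_mul _),
    integral_add (integrable_const _) ((hxi B).const_mul _)] at h
  simp only [integral_const_mul, integral_const, probReal_univ, smul_eq_mul, one_mul] at h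
  have h' := nonneg_of_mul_nonneg_right h hn0
  -- Each linear variance is at most 4, so half the integral is at most `4 + 24 + 6 + 6 = 40`.
  linarith

end Fluctuations

/-! ### Entries of the output as quadratic traces -/

section Output

/-- The operator `e_{ab} ⊗ 1`. -/
def blockUnit {k b : Type*} [DecidableEq k] [DecidableEq b] (i j : k) :
    Matrix (k × b) (k × b) ℂ :=
  Matrix.single i j 1 ⊗ₖ 1

variable {k b : Type*} [Fintype k] [DecidableEq k] [Fintype b] [DecidableEq b]

lemma trace_blockUnit (i j : k) :
    (blockUnit i j : Matrix (k × b) (k × b) ℂ).trace = if i = j then (Fintype.card b : ℂ) else 0 := by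
  rw [blockUnit, Matrix.trace_kronecker, Matrix.trace_one]
  split_ifs with h
  · subst h; simp
  · rw [Matrix.trace_single_eq_of_ne _ _ _ h, zero_mul]

lemma blockUnit_mul (i j i' j' : k) :
    (blockUnit i j * blockUnit i' j' : Matrix (k × b) (k × b) ℂ) =
      if j = i' then blockUnit i j' else 0 := by
  rw [blockUnit, blockUnit, ← Matrix.mul_kronecker_mul, one_mul]
  split_ifs with h
  · subst h; simp [blockUnit]
  · rw [Matrix.single_mul_single_of_ne _ _ _ _ h, Matrix.zero_kronecker]

omit [Fintype k] [Fintype b] in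
lemma conjTranspose_blockUnit (i j : k) :
    (blockUnit i j : Matrix (k × b) (k × b) ℂ)ᴴ = blockUnit j i := by
  simp [blockUnit, Matrix.conjTranspose_kronecker, Matrix.conjTranspose_single]

open scoped Matrix.Norms.L2Operator in
lemma norm_blockUnit_le (i j : k) : ‖(blockUnit i j : Matrix (k × b) (k × b) ℂ)‖ ≤ 1 := by
  have h : IsStarProjection (blockUnit j j : Matrix (k × b) (k × b) ℂ) :=
    ⟨by rw [IsIdempotentElem, blockUnit_mul, if_pos rfl],
      by rw [IsSelfAdjoint, Matrix.star_eq_conjTranspose, conjTranspose_blockUnit]⟩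
  have h2 : ‖(blockUnit i j : Matrix (k × b) (k × b) ℂ)‖ * ‖(blockUnit i j : Matrix (k × b) (k × b) ℂ)‖
      ≤ 1 := by
    rw [← CStarRing.norm_star_mul_self, Matrix.star_eq_conjTranspose, conjTranspose_blockUnit,
      blockUnit_mul, if_pos rfl]
    exact h.norm_le
  nlinarith [norm_nonneg (blockUnit i j : Matrix (k × b) (k × b) ℂ)]

lemma trace_blockUnit_mul_mul (P : Matrix (k × b) (k × b) ℂ) (i j i' j' : k) :
    (blockUnit i j * P * blockUnit i' j' * P).trace =
      ∑ s, ∑ u, P (j, s) (i', u) * P (j', u) (i, s) := by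
  have h : ∀ (i j : k) (x y : k × b), (blockUnit i j * P : Matrix (k × b) (k × b) ℂ) x y =
       if x.1 = i then P (j, x.2) y else 0 := by
    intro i j x y
    simp [blockUnit, Matrix.mul_apply, Matrix.kroneckerMap_apply, Fintype.sum_prod_type,
      Matrix.single_apply, Matrix.one_apply, ite_and, eq_comm]
  rw [mul_assoc, Matrix.trace]
  simp [Matrix.mul_apply (M := blockUnit i j * P), h, Fintype.sum_prod_type]

omit [Fintype k] [DecidableEq k] [DecidableEq b] in
lemma channel_single {d : ℕ} (V : Matrix (k × b) (Fin d) ℂ) (i j : Fin d) (x y : k) :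
    channel V (Matrix.single i j 1) x y = ∑ s, V (x, s) i * conj (V (y, s) j) := by
  simp [channel, partialTrace, Matrix.mul_apply, Matrix.single_apply, ite_and]

omit [Fintype k] [DecidableEq k] [DecidableEq b] in
lemma bellOutput_apply {d : ℕ} (V : Matrix (k × b) (Fin d) ℂ) (p q : k × k) :
    bellOutput V p q = 1 / (d : ℂ) * ∑ i, ∑ j, (∑ s, V (p.1, s) i * conj (V (q.1, s) j)) *
      ∑ s, conj (V (p.2, s) i) * V (q.2, s) j := by
  have hω : ∀ x : Fin d × Fin d, bellVector d x = if x.1 = x.2 then 1 / (√d : ℂ) else 0 := by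
    intro x
    simp [bellVector, Finset.sum_apply, Pi.single_apply, Prod.ext_iff, ite_and, eq_comm]
  have hΩ : ∀ x y : Fin d × Fin d, bellState d x y =
      if y.1 = y.2 then (if x.1 = x.2 then 1 / (d : ℂ) else 0) else 0 := by
    intro x y
    have hd : ((√d : ℝ) : ℂ) * (√d : ℝ) = d := by
      rw [← Complex.ofReal_mul, Real.mul_self_sqrt (by positivity), Complex.ofReal_natCast]
    simp only [bellState, Matrix.vecMulVec_apply, Pi.star_apply, hω]
    split_ifs <;> simp [← mul_inv, hd]
  simp only [bellOutput, tensorMap, LinearMap.coe_mk, AddHom.coe_mk, Matrix.sum_apply,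
    Matrix.smul_apply, Matrix.kroneckerMap_apply, channel_single, Matrix.map_apply, smul_eq_mul,
    Complex.conj_conj, hΩ, Fintype.sum_prod_type, ite_mul, zero_mul, Finset.sum_ite_eq,
    Finset.mem_univ, if_true]
  rw [Finset.mul_sum]
  refine Finset.sum_congr rfl fun i _ => ?_
  rw [Finset.sum_comm, Finset.mul_sum]
  simp

/-- The Bell state identifies the input indices of the two channels. Summing over `i` joins the two
row blocks through `V Vᴴ`, and summing over `j` joins the two column blocks. -/
lemma bellOutput_eq_trace {d : ℕ} (V : Matrix (k × b) (Fin d) ℂ) (p q : k × k) :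
    bellOutput V p q = 1 / (d : ℂ) *
      (blockUnit p.2 q.2 * (V * Vᴴ) * blockUnit q.1 p.1 * (V * Vᴴ)).trace := by
  rw [bellOutput_apply, trace_blockUnit_mul_mul]
  congr 1
  simp only [Matrix.mul_apply, Matrix.conjTranspose_apply, Finset.sum_mul_sum]
  have h : ∀ f : Fin d → Fin d → b → b → ℂ, ∑ i, ∑ j, ∑ s, ∑ u, f i j s u =
      ∑ u, ∑ s, ∑ j, ∑ i, f i j s u := by
    intro f
    calc _ = ∑ i, ∑ s, ∑ u, ∑ j, f i j s u := by
          refine Finset.sum_congr rfl fun i _ => ?_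
          rw [Finset.sum_comm]
          exact Finset.sum_congr rfl fun s _ => Finset.sum_comm
      _ = ∑ s, ∑ u, ∑ i, ∑ j, f i j s u := by
          rw [Finset.sum_comm]
          exact Finset.sum_congr rfl fun s _ => Finset.sum_comm
      _ = _ := by
          rw [Finset.sum_comm]
          exact Finset.sum_congr rfl fun s _ => Finset.sum_congr rfl fun u _ => Finset.sum_comm
  rw [h]
  refine Finset.sum_congr rfl fun u _ => Finset.sum_congr rfl fun s _ =>
    Finset.sum_congr rfl fun j _ => Finset.sum_congr rfl fun i _ => ?_
  simp only [starRingEnd_apply]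
  ring

/-- The deterministic approximation of `bellOutput` for a random isometry of density `τ`. -/
noncomputable def bellLimit (k : Type*) [Fintype k] [DecidableEq k] (τ : ℝ) : Matrix (k × k) (k × k) ℂ :=
  ((τ / Fintype.card k : ℝ) : ℂ) • Matrix.vecMulVec (fun p => if p.1 = p.2 then 1 else 0)
    (fun p => if p.1 = p.2 then 1 else 0) + (((1 - τ) / Fintype.card k ^ 2 : ℝ) : ℂ) • 1

/-- The `Tr (B A)` term yields the rank-one part and the `Tr A Tr B` terms yield the identity part.
-/
lemma quadMean_blockUnit [Nonempty k] [Nonempty b] {d : ℕ} (hd : d ≠ 0) (p q : k × k) :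
    1 / (d : ℂ) * quadMean d (blockUnit p.2 q.2 : Matrix (k × b) (k × b) ℂ) (blockUnit q.1 p.1) =
      bellLimit k (d / (Fintype.card b * Fintype.card k)) p q := by
  have h1 : (Fintype.card k : ℂ) ≠ 0 := by simp
  have h2 : (Fintype.card b : ℂ) ≠ 0 := by simp
  have h3 : (d : ℂ) ≠ 0 := by simpa using hd
  obtain ⟨a, a'⟩ := p
  obtain ⟨c, c'⟩ := q
  have hone : (1 : Matrix (k × k) (k × k) ℂ) (a, a') (c, c') =
      if c = a then (if a' = c' then 1 else 0) else 0 := by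
    simp only [Matrix.one_apply, Prod.mk.injEq, ite_and, eq_comm (a := a)]
  simp only [quadMean, bellLimit, Matrix.add_apply, Matrix.smul_apply, Matrix.vecMulVec_apply, hone,
    blockUnit_mul, trace_blockUnit, Fintype.card_prod, smul_eq_mul]
  push_cast
  split_ifs <;> simp_all [trace_blockUnit] <;> field_simp <;> ring

open scoped Matrix.Norms.L2Operator in
theorem integral_norm_sq_bellOutput_sub_le [Nonempty k] [Nonempty b] {d : ℕ} (hd : d ≠ 0)
    {J : Matrix (k × b) (Fin d) ℂ} (hJ : Jᴴ * J = 1) (p q : k × k) :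
    ∫ U : Matrix.unitaryGroup (k × b) ℂ,
      ‖bellOutput ((U : Matrix (k × b) (k × b) ℂ) * J) p q -
        bellLimit k (d / (Fintype.card b * Fintype.card k)) p q‖ ^ 2 ∂haarUnitary (k × b) ≤
      80 / (d : ℝ) ^ 2 := by
  have hQ : IsStarProjection (J * Jᴴ) := by
    refine ⟨?_, ?_⟩
    · rw [IsIdempotentElem, Matrix.mul_assoc, ← Matrix.mul_assoc Jᴴ, hJ, Matrix.one_mul]
    · rw [IsSelfAdjoint, Matrix.star_eq_conjTranspose, Matrix.conjTranspose_mul,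
        Matrix.conjTranspose_conjTranspose]
  have htr : (J * Jᴴ).trace = d := by rw [Matrix.trace_mul_comm, hJ]; simp
  have key := integral_norm_sq_quad_sub_quadMean_le (norm_blockUnit_le (b := b) p.2 q.2)
    (norm_blockUnit_le (b := b) q.1 p.1) hQ
  rw [htr] at key
  have e : ∀ U : Matrix.unitaryGroup (k × b) ℂ,
      ‖bellOutput ((U : Matrix (k × b) (k × b) ℂ) * J) p q -
        bellLimit k (d / (Fintype.card b * Fintype.card k)) p q‖ ^ 2 = 1 / (d : ℝ) ^ 2 *
      ‖((blockUnit p.2 q.2 : Matrix (k × b) (k × b) ℂ) * unitaryConj (J * Jᴴ) U * blockUnit q.1 p.1 *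
        unitaryConj (J * Jᴴ) U).trace -
        quadMean d (blockUnit p.2 q.2 : Matrix (k × b) (k × b) ℂ) (blockUnit q.1 p.1)‖ ^ 2 := by
    intro U
    have hU : (U : Matrix (k × b) (k × b) ℂ) * J * ((U : Matrix (k × b) (k × b) ℂ) * J)ᴴ =
        unitaryConj (J * Jᴴ) U := by
      simp [unitaryConj, Matrix.conjTranspose_mul, Matrix.mul_assoc, Matrix.star_eq_conjTranspose]
    rw [bellOutput_eq_trace, ← quadMean_blockUnit (b := b) hd, ← mul_sub, norm_mul, mul_pow, hU]
    simp
  simp_rw [e]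
  rw [integral_const_mul, div_eq_mul_one_div (80 : ℝ), mul_comm (80 : ℝ)]
  exact mul_le_mul_of_nonneg_left key (by positivity)

end Output

/-! ### Eigenvalues from moments -/

section Eigenvalues

/-- The largest term lies between `∑ x³ / ∑ x²`, a weighted average of the terms, and `√(∑ x²)`;
both tend to `t`. It then exhausts the second moment, forcing the others to zero. -/
lemma tendsto_of_antitone_of_power_sums {m : ℕ} {x : ℕ → Fin m → ℝ} {t : ℝ} (ht : 0 < t)
    (hx : ∀ n, Antitone (x n))
    (h2 : Tendsto (fun n => ∑ i, x n i ^ 2) atTop (𝓝 (t ^ 2)))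
    (h3 : Tendsto (fun n => ∑ i, x n i ^ 3) atTop (𝓝 (t ^ 3))) (i : Fin m) :
    Tendsto (fun n => x n i) atTop (𝓝 (if (i : ℕ) = 0 then t else 0)) := by
  have hm : 0 < m := i.pos
  set o : Fin m := ⟨0, hm⟩
  have hmax : Tendsto (fun n => x n o) atTop (𝓝 t) := by
    have hl : Tendsto (fun n => (∑ i, x n i ^ 3) / ∑ i, x n i ^ 2) atTop (𝓝 t) := by
      have := h3.div h2 (by positivity)
      have e : t ^ 3 / t ^ 2 = t := by field_simp
      rwa [e] at this
    have hu : Tendsto (fun n => √(∑ i, x n i ^ 2)) atTop (𝓝 t) := by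
      have := h2.sqrt
      rwa [Real.sqrt_sq ht.le] at this
    refine tendsto_of_tendsto_of_tendsto_of_le_of_le' hl hu ?_ (Eventually.of_forall fun n => ?_)
    · filter_upwards [h2.eventually_const_lt (show 0 < t ^ 2 by positivity)] with n hn
      rw [div_le_iff₀ hn, Finset.mul_sum]
      refine Finset.sum_le_sum fun j _ => ?_
      rw [pow_succ, mul_comm]
      exact mul_le_mul_of_nonneg_right (hx n (Fin.mk_le_of_le_val (Nat.zero_le _))) (sq_nonneg _)
    · apply Real.le_sqrt_of_sq_le
      exact Finset.single_le_sum (f := fun j => x n j ^ 2) (fun j _ => sq_nonneg _)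
        (Finset.mem_univ o)
  by_cases hi : (i : ℕ) = 0
  · rw [if_pos hi]
    have : i = o := Fin.ext hi
    rwa [this]
  · rw [if_neg hi]
    have hd : Tendsto (fun n => ∑ i, x n i ^ 2 - x n o ^ 2) atTop (𝓝 0) := by
      simpa using h2.sub (hmax.pow 2)
    have hsq : Tendsto (fun n => x n i ^ 2) atTop (𝓝 0) := by
      refine squeeze_zero (fun n => sq_nonneg _) (fun n => ?_) hd
      have hio : i ≠ o := fun h => hi (congrArg Fin.val h)
      have := Finset.sum_le_sum_of_subset_of_nonneg (f := fun j => x n j ^ 2)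
        (Finset.subset_univ {i, o}) (fun j _ _ => sq_nonneg _)
      rw [Finset.sum_pair hio] at this
      linarith
    have := hsq.sqrt
    simp only [Real.sqrt_sq_eq_abs, Real.sqrt_zero] at this
    exact (tendsto_zero_iff_abs_tendsto_zero _).2 this

lemma sum_eigenvalues₀_sub_pow {m : Type*} [Fintype m] [DecidableEq m] {A : Matrix m m ℂ}
    (hA : A.IsHermitian) (c : ℝ) (p : ℕ) :
    ∑ i, (hA.eigenvalues₀ i - c) ^ p = ((A - (c : ℂ) • 1) ^ p).trace.re := by
  have h1 : A - (c : ℂ) • 1 = Unitary.conjStarAlgAut ℂ _ hA.eigenvectorUnitary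
      (Matrix.diagonal fun i => ((hA.eigenvalues i - c : ℝ) : ℂ)) := by
    conv_lhs => rw [hA.spectral_theorem]
    rw [← map_one (Unitary.conjStarAlgAut ℂ _ hA.eigenvectorUnitary), ← map_smul, ← map_sub]
    congr 1
    rw [← Matrix.diagonal_one, ← Matrix.diagonal_smul, Matrix.diagonal_sub]
    congr 1
    ext i
    simp
  have h2 : ((A - (c : ℂ) • 1) ^ p).trace = ∑ i, ((hA.eigenvalues i - c : ℝ) : ℂ) ^ p := by
    rw [h1, ← map_pow, Matrix.diagonal_pow, Unitary.conjStarAlgAut_apply, Matrix.trace_mul_comm,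
      ← mul_assoc]
    rw [Unitary.coe_star_mul_self, one_mul, Matrix.trace_diagonal]
    simp
  rw [h2]
  have h3 : ∑ i, ((hA.eigenvalues i - c : ℝ) : ℂ) ^ p =
      ((∑ i, (hA.eigenvalues i - c) ^ p : ℝ) : ℂ) := by push_cast; rfl
  rw [h3, Complex.ofReal_re]
  exact (Equiv.sum_comp (Fintype.equivOfCardEq (Fintype.card_fin _)).symm
    fun i => (hA.eigenvalues₀ i - c) ^ p).symm

/-- The conditions on `W` describe `t` times a rank-one projection, giving `Tr W² = t²` and `Tr W³ =
t³`. Traces of powers are continuous in the entries, so the moments of the shifted eigenvalues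
converge. -/
lemma tendsto_eigenvalues₀ {m : Type*} [Fintype m] [DecidableEq m] {A : ℕ → Matrix m m ℂ}
    {W : Matrix m m ℂ} (hA : ∀ n, (A n).IsHermitian) {t c : ℝ} (ht : 0 < t)
    (hW : W * W = (t : ℂ) • W) (hWt : W.trace = t)
    (h : Tendsto A atTop (𝓝 (W + (c : ℂ) • 1))) (i : Fin (Fintype.card m)) :
    Tendsto (fun n => (hA n).eigenvalues₀ i) atTop (𝓝 (if (i : ℕ) = 0 then t + c else c)) := by
  have hp : ∀ p : ℕ, Tendsto (fun n => ∑ i, ((hA n).eigenvalues₀ i - c) ^ p) atTop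
      (𝓝 (W ^ p).trace.re) := by
    intro p
    have hc : Continuous fun M : Matrix m m ℂ => ((M - (c : ℂ) • 1) ^ p).trace.re :=
      Complex.continuous_re.comp (by fun_prop)
    have := (hc.tendsto _).comp h
    rw [add_sub_cancel_right] at this
    simpa only [sum_eigenvalues₀_sub_pow, Function.comp_def] using this
  have e2 : (W ^ 2).trace.re = t ^ 2 := by
    rw [pow_two, hW, Matrix.trace_smul, hWt, smul_eq_mul, ← Complex.ofReal_mul, Complex.ofReal_re,
      pow_two]
  have e3 : (W ^ 3).trace.re = t ^ 3 := by
    rw [pow_succ, pow_two, hW, Matrix.smul_mul, hW, Matrix.trace_smul, Matrix.trace_smul, hWt,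
      smul_eq_mul, smul_eq_mul, ← Complex.ofReal_mul, ← Complex.ofReal_mul, Complex.ofReal_re]
    ring
  have key := tendsto_of_antitone_of_power_sums ht
    (x := fun n i => (hA n).eigenvalues₀ i - c)
    (fun n i j hij => sub_le_sub_right ((hA n).eigenvalues₀_antitone hij) c)
    (e2 ▸ hp 2) (e3 ▸ hp 3) i
  have := key.add_const c
  simp only [sub_add_cancel] at this
  convert this using 2
  split_ifs <;> simp

end Eigenvalues

/-! ### Almost sure convergence from summable second moments -/

section AlmostSure

/-- By Tonelli a tail of `∑ g n` has finite integral, hence is finite almost everywhere and its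
terms vanish. No independence enters. -/
lemma ae_tendsto_zero_of_lintegral_le {Ω : Type*} [MeasurableSpace Ω] {P : Measure Ω}
    {g : ℕ → Ω → ℝ} {c : ℕ → ℝ} (hg0 : ∀ n ω, 0 ≤ g n ω) (hc : Summable c)
    (hg : ∀ᶠ n in atTop, AEMeasurable (g n) P ∧
      ∫⁻ ω, ENNReal.ofReal (g n ω) ∂P ≤ ENNReal.ofReal (c n)) :
    ∀ᵐ ω ∂P, Tendsto (fun n => g n ω) atTop (𝓝 0) := by
  obtain ⟨m, hm⟩ := eventually_atTop.1 hg
  have hmeas : ∀ n, AEMeasurable (fun ω => ENNReal.ofReal (g (n + m) ω)) P := fun n =>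
    (hm (n + m) (Nat.le_add_left _ _)).1.ennreal_ofReal
  have hsum : ∫⁻ ω, ∑' n, ENNReal.ofReal (g (n + m) ω) ∂P ≠ ⊤ := by
    rw [lintegral_tsum hmeas]
    refine ne_top_of_le_ne_top ?_
      (ENNReal.tsum_le_tsum fun n => (hm (n + m) (Nat.le_add_left _ _)).2)
    exact ((summable_nat_add_iff m).2 hc).tsum_ofReal_ne_top
  filter_upwards [ae_lt_top' (AEMeasurable.tsum hmeas) hsum] with ω hω
  have h1 := ENNReal.tendsto_atTop_zero_of_tsum_ne_top hω.ne
  have h2 := (ENNReal.tendsto_toReal ENNReal.zero_ne_top).comp h1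
  rw [← tendsto_add_atTop_iff_nat m]
  simpa [Function.comp_def, ENNReal.toReal_ofReal (hg0 _ _)] using h2

variable {k b : Type*} [Fintype k] [DecidableEq k] [Fintype b] [DecidableEq b]

omit [Fintype k] [DecidableEq k] [DecidableEq b] in
lemma continuous_bellOutput_apply {d : ℕ} (p q : k × k) :
    Continuous fun V : Matrix (k × b) (Fin d) ℂ => bellOutput V p q := by
  simp only [bellOutput_apply]
  have h : ∀ (x : k × b) (i : Fin d), Continuous fun V : Matrix (k × b) (Fin d) ℂ => V x i :=
    fun x i => (continuous_apply i).comp (continuous_apply x)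
  have h' : ∀ (x : k × b) (i : Fin d), Continuous fun V : Matrix (k × b) (Fin d) ℂ => conj (V x i) :=
    fun x i => Complex.continuous_conj.comp (h x i)
  refine continuous_const.mul (continuous_finsetSum _ fun i _ => continuous_finsetSum _ fun j _ => ?_)
  exact (continuous_finsetSum _ fun s _ => (h _ _).mul (h' _ _)).mul
    (continuous_finsetSum _ fun s _ => (h' _ _).mul (h _ _))

theorem lintegral_norm_sq_bellOutput_sub_le {Ω : Type*} [MeasurableSpace Ω] {P : Measure Ω}
    [Nonempty k] [Nonempty b] {d : ℕ} (hd : d ≠ 0) {V : Ω → Matrix (k × b) (Fin d) ℂ}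
    (hV : IsRandomIsometry V P) (p q : k × k) :
    ∫⁻ ω, ENNReal.ofReal (‖bellOutput (V ω) p q -
      bellLimit k (d / (Fintype.card b * Fintype.card k)) p q‖ ^ 2) ∂P ≤
      ENNReal.ofReal (80 / (d : ℝ) ^ 2) := by
  obtain ⟨J, hJ, hlaw⟩ := hV
  have hc : Continuous fun W : Matrix (k × b) (Fin d) ℂ => ‖bellOutput W p q -
      bellLimit k (d / (Fintype.card b * Fintype.card k)) p q‖ ^ 2 :=
    (((continuous_bellOutput_apply p q).sub continuous_const).norm).pow 2
  have hUJ : Continuous fun U : Matrix.unitaryGroup (k × b) ℂ => (U : Matrix (k × b) (k × b) ℂ) * J :=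
    continuous_subtype_val.matrix_mul continuous_const
  have hm := hc.measurable.ennreal_ofReal
  rw [hlaw.lintegral_comp (f := fun W => ENNReal.ofReal (‖bellOutput W p q -
      bellLimit k (d / (Fintype.card b * Fintype.card k)) p q‖ ^ 2)) hm.aemeasurable,
    lintegral_map hm hUJ.measurable, ← ofReal_integral_eq_lintegral_ofReal]
  · exact ENNReal.ofReal_le_ofReal (integral_norm_sq_bellOutput_sub_le hd hJ p q)
  · exact (hc.comp hUJ).integrable_of_hasCompactSupport (HasCompactSupport.of_compactSpace _)
  · exact Eventually.of_forall fun U => by positivity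

lemma continuous_bellLimit : Continuous (bellLimit k) := by
  unfold bellLimit
  have h1 : Continuous fun τ : ℝ => ((τ / Fintype.card k : ℝ) : ℂ) :=
    Complex.continuous_ofReal.comp (by fun_prop)
  have h2 : Continuous fun τ : ℝ => (((1 - τ) / Fintype.card k ^ 2 : ℝ) : ℂ) :=
    Complex.continuous_ofReal.comp (by fun_prop)
  exact (h1.smul continuous_const).add (h2.smul continuous_const)

end AlmostSure

end RandomChannel

/-! ### The main theorem -/

open RandomChannel in
theorem mainTheorem3 {Ω : Type*} [MeasurableSpace Ω] (P : Measure Ω) [IsProbabilityMeasure P]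
    (k : ℕ) (hk : 1 ≤ k) (t : ℝ) (ht : t ∈ Set.Ioo (0 : ℝ) 1)
    (d : ℕ → ℕ)
    (hd : Asymptotics.IsEquivalent atTop (fun n => (d n : ℝ)) (fun n : ℕ => t * n * k))
    (V : (n : ℕ) → Ω → Matrix (Fin k × Fin n) (Fin (d n)) ℂ)
    (hV : ∀ᶠ n in atTop, RandomChannel.IsRandomIsometry (V n) P) :
    -- the eigenvalues with multiplicity, in decreasing order
    ∀ᵐ ω ∂P, ∀ i : Fin (Fintype.card (Fin k × Fin k)),
      Tendsto
        (fun n => (RandomChannel.bellOutput_isHermitian (V n ω)).eigenvalues₀ i) atTop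
        (𝓝 (if (i : ℕ) = 0 then t + (1 - t) / (k : ℝ) ^ 2 else (1 - t) / (k : ℝ) ^ 2)) := by
  have ht0 : 0 < t := ht.1
  have hk0 : (0 : ℝ) < k := by exact_mod_cast hk
  have : Nonempty (Fin k) := ⟨⟨0, hk⟩⟩
  have hu0 : ∀ᶠ n : ℕ in atTop, t * n * k ≠ 0 := by
    filter_upwards [eventually_gt_atTop 0] with n hn
    positivity
  have hratio : Tendsto (fun n : ℕ => (d n : ℝ) / (n * k)) atTop (𝓝 t) := by
    have h1 := ((Asymptotics.isEquivalent_iff_tendsto_one hu0).1 hd).const_mul t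
    rw [mul_one] at h1
    refine h1.congr' ?_
    filter_upwards [eventually_gt_atTop 0] with n hn
    simp only [Pi.div_apply]
    field_simp
  have hd0 : ∀ᶠ n in atTop, d n ≠ 0 := by
    filter_upwards [hratio.eventually_const_lt ht0] with n hn h
    simp [h] at hn
  -- Since `d n` grows like `t k n`, the bounds are comparable to `1/n²`.
  have hsum : Summable fun n => 80 / (d n : ℝ) ^ 2 := by
    have h1 : Summable fun n : ℕ => ((n : ℝ) ^ 2)⁻¹ := Real.summable_nat_pow_inv.2 one_lt_two
    refine summable_of_isBigO_nat (h1.mul_left (80 / (t * k) ^ 2)) ?_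
    have h2 := ((hd.inv.pow 2).isBigO).const_mul_left 80
    refine (h2.congr_left fun n => ?_).trans (Asymptotics.isBigO_of_le' (c := (1 / 80 : ℝ)) _ fun n => ?_)
    · simp [div_eq_mul_inv]
    · refine le_of_eq ?_
      rw [← Real.norm_of_nonneg (show (0 : ℝ) ≤ 1 / 80 by norm_num), ← norm_mul]
      congr 1
      simp only [Pi.pow_apply, Pi.inv_apply]
      field_simp
  have hentry : ∀ᵐ ω ∂P, ∀ p q : Fin k × Fin k, Tendsto (fun n => ‖bellOutput (V n ω) p q -
      bellLimit (Fin k) (d n / (n * k)) p q‖ ^ 2) atTop (𝓝 0) := by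
    rw [ae_all_iff]
    intro p
    rw [ae_all_iff]
    intro q
    refine ae_tendsto_zero_of_lintegral_le (fun n ω => by positivity)
      hsum ?_
    filter_upwards [hV, hd0, eventually_gt_atTop 0] with n hn hdn hn0
    have : Nonempty (Fin n) := ⟨⟨0, hn0⟩⟩
    constructor
    · have hm := hn.choose_spec.2.aemeasurable
      exact (((((continuous_bellOutput_apply p q).sub continuous_const).norm).pow
        2).measurable).comp_aemeasurable hm
    · simpa only [Fintype.card_fin] using lintegral_norm_sq_bellOutput_sub_le hdn hn p q
  filter_upwards [hentry] with ω hω i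
  have hlim : Tendsto (fun n => bellOutput (V n ω)) atTop (𝓝 (bellLimit (Fin k) t)) := by
    refine tendsto_pi_nhds.2 fun p => tendsto_pi_nhds.2 fun q => ?_
    have h1 : Tendsto (fun n => bellLimit (Fin k) (d n / (n * k)) p q) atTop
        (𝓝 (bellLimit (Fin k) t p q)) :=
      tendsto_pi_nhds.1 (tendsto_pi_nhds.1 ((continuous_bellLimit.tendsto t).comp hratio) p) q
    have h2 : Tendsto (fun n => bellOutput (V n ω) p q -
        bellLimit (Fin k) (d n / (n * k)) p q) atTop (𝓝 0) := by
      rw [tendsto_zero_iff_norm_tendsto_zero]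
      have := (hω p q).sqrt
      simpa only [Real.sqrt_sq (norm_nonneg _), Real.sqrt_zero] using this
    simpa using h2.add h1
  have hkC : (k : ℂ) ≠ 0 := by exact_mod_cast hk0.ne'
  -- The unnormalised Bell vector has squared length `k`, so the factor `t / k` gives `W` trace `t`
  -- and `W² = t W`.
  have hdot : (fun p : Fin k × Fin k => if p.1 = p.2 then (1 : ℂ) else 0) ⬝ᵥ
      (fun p => if p.1 = p.2 then 1 else 0) = k := by
    simp [dotProduct, Fintype.sum_prod_type]
  have := tendsto_eigenvalues₀ (fun n => bellOutput_isHermitian (V n ω)) (c := (1 - t) / (k : ℝ) ^ 2)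
    (W := ((t / k : ℝ) : ℂ) • Matrix.vecMulVec (fun p => if p.1 = p.2 then 1 else 0)
      (fun p => if p.1 = p.2 then 1 else 0)) ht0 ?_ ?_ ?_ i
  · exact this
  · rw [Matrix.smul_mul, Matrix.mul_smul, Matrix.vecMulVec_mul_vecMulVec, hdot, smul_smul, smul_smul,
      Matrix.vecMulVec_smul, smul_smul]
    congr 1
    push_cast
    field_simp
  · rw [Matrix.trace_smul, Matrix.trace_vecMulVec, hdot]
    push_cast
    rw [smul_eq_mul]
    field_simp
  · simpa only [bellLimit, Fintype.card_fin] using hlim
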